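/- A tournament is a loopless digraph in which every two distinct vertices $u,v$ are joined by exactly one of the edges $(u,v)$, $(v,u)$. An arborescence is an oriented tree with a designated root from which every vertex of the tree is reachable by a directed path of the tree; its depth is the length of a longest directed path in it. In an edge-coloured tournament, an arborescence contained in the tournament is path-monochromatic if each of its directed paths has all its edges of one colour. For a tournament $T$ and positive integers $k,\ell$, let $f_T(k,\ell)$ be the largest integer $m$ such that every colouring of the edges of $T$ with $k$ colours has a path-monochromatic arborescence of depth at most $\ell$ with at least $m$ vertices. Let $f^*(k,\ell,n)$ be the random variable $f_T(k,\ell)$, where $T$ is the random tournament on $n$ labelled vertices in which the direction of each edge is chosen independently by a fair coin flip. "Whp" means with probability tending to $1$ as $n\to\infty$. **Theorem.** (a) There is a function $g(n)=o(n)$ such that whp $f^*(2,2,n)+g(n)\ge \frac{49}{72}n$. (b) There is a function $g(n)=o(n)$ such that whp $f^*(2,2,n)-g(n)\le \frac34 n$. -/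

import Mathlib

open MeasureTheory Filter Topology Asymptotics

/-- A tournament on the vertex set `V`: a loopless digraph in which, for any two distinct vertices
`u` and `v`, exactly one of `(u, v)` and `(v, u)` is an edge. -/
@[ext]
structure Tournament (V : Type*) extends Digraph V where
  loopless : ∀ v, ¬ Adj v v
  adj_iff_not_adj : ∀ u v, u ≠ v → (Adj u v ↔ ¬ Adj v u)

/-- `IsDirPath D p`: the list `p` is the vertex sequence of a directed path of the digraph `D`.
Its length (number of edges) is `p.length - 1`. -/
def IsDirPath {V : Type*} (D : Digraph V) (p : List V) : Prop :=
  p ≠ [] ∧ p.Nodup ∧ p.IsChain D.Adj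

/-- The path `p` is monochromatic with respect to the edge colouring `c`. -/
def IsMonochromatic {V : Type*} {k : ℕ} (c : V → V → Fin k) (p : List V) : Prop :=
  ∃ a : Fin k, p.IsChain (fun u v => c u v = a)

/-- An arborescence contained in the tournament `T`: a subdigraph of `T`, with at least one vertex,
whose underlying undirected graph is a tree, with a designated root from which every vertex of the
tree can be reached by a directed path of the tree. -/
structure Arborescence {V : Type*} (T : Tournament V) where
  /-- the vertices of the arborescence -/
  verts : Finset V
  /-- the edges of the arborescence, as a digraph on the whole of `V` -/
  edges : Digraph V
  root : V
  root_mem : root ∈ verts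
  adj_of_edge : ∀ u v, edges.Adj u v → T.Adj u v
  mem_of_edge : ∀ u v, edges.Adj u v → u ∈ verts ∧ v ∈ verts
  isTree : ((SimpleGraph.fromRel edges.Adj).induce (verts : Set V)).IsTree
  reach : ∀ v ∈ verts, ∃ p : List V,
    IsDirPath edges p ∧ p.head? = some root ∧ p.getLast? = some v

namespace Arborescence

variable {V : Type*} {T : Tournament V}

/-- Every directed path in the arborescence is monochromatic. -/
def PathMonochromatic {k : ℕ} (A : Arborescence T) (c : V → V → Fin k) : Prop :=
  ∀ p, IsDirPath A.edges p → IsMonochromatic c p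

/-- The depth of the arborescence, i.e. the length of a longest directed path in it,
is at most `l`. -/
def DepthLE (A : Arborescence T) (l : ℕ) : Prop :=
  ∀ p, IsDirPath A.edges p → p.length - 1 ≤ l

end Arborescence

/-- `f_T(k, l)`: the largest integer `m` such that every `k`-edge-colouring of `T` has a
path-monochromatic arborescence of depth at most `l` with at least `m` vertices.
A `k`-edge-colouring (`k ≥ 1`) is given by a function on all ordered pairs of vertices, of which
only the values on the edges of `T` are ever used. -/
noncomputable def maxArborescence {V : Type*} (T : Tournament V) (k l : ℕ) : ℕ :=
  sSup {m : ℕ | ∀ c : V → V → Fin k,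
    ∃ A : Arborescence T, A.PathMonochromatic c ∧ A.DepthLE l ∧ m ≤ A.verts.card}

/-- The unordered pairs of distinct elements of `Fin n`, each written with its smaller element
first. -/
abbrev VertexPair (n : ℕ) : Type := {e : Fin n × Fin n // e.1 < e.2}

/-- The tournament on `Fin n` in which the edge between `u < v` is directed from `u` to `v` if the
coin of the pair shows `true`, and from `v` to `u` if it shows `false`. -/
def Tournament.ofCoins {n : ℕ} (ω : VertexPair n → Bool) : Tournament (Fin n) where
  Adj u v := (∃ h : u < v, ω ⟨(u, v), h⟩ = true) ∨ (∃ h : v < u, ω ⟨(v, u), h⟩ = false)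
  loopless v := by simp
  adj_iff_not_adj u v huv := by
    rcases lt_or_gt_of_ne huv with h | h
    · simp [h, h.not_gt]
    · simp [h, h.not_gt]

/-- All sets of tournaments are events. -/
instance (V : Type*) : MeasurableSpace (Tournament V) := ⊤

/-- The law of a fair coin flip. -/
noncomputable def fairCoin : Measure Bool := (PMF.uniformOfFintype Bool).toMeasure

/-- The law of a random tournament on `n` vertices: the direction of each edge is chosen
independently by a fair coin flip. -/
noncomputable def randomTournament (n : ℕ) : Measure (Tournament (Fin n)) :=
  (Measure.pi (fun _ : VertexPair n => fairCoin)).map Tournament.ofCoins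

instance : IsProbabilityMeasure fairCoin := by
  unfold fairCoin; infer_instance

instance (n : ℕ) : IsProbabilityMeasure (randomTournament n) :=
  Measure.isProbabilityMeasure_map (measurable_of_finite _).aemeasurable

/-!
The lower bound rests on counting triangles. Fix a colouring of the tournament with two colours and
call an edge `w → v` *good* if `v` reaches `w` by a monochromatic path of length two. The vertices
that `v` does not reach by monochromatic paths of length at most two are the tails of the edges
into `v` that are not good, so it suffices to show that many edges are good. Two of the three edges
of a cyclic triangle have the same colour, and then the third is good: the good edges meet every
cyclic triangle.

In a tournament of small discrepancy such a set of edges contains asymptotically at least `3/8` of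
all edges (`cover_edge_count`). Let `p v` and `q v` be the numbers of good edges into and out of
`v`, let `e` be the number of good edges, and ignore lower order terms. A cyclic triangle with
`j ≥ 1` good edges has `j - 1 ≥ 2/3 * (j choose 2)`, and summing this over all cyclic triangles
bounds the number of paths of two good edges above: `∑ p v * q v ≤ 3/4 * e * n - n³ / 8`.
On the other hand, inclusion–exclusion in transitive triangles gives
`∑ (p v ^ 2 + q v ^ 2) / 2 ≤ ∑ p v * q v / 2 + e * n / 4`, and `∑ (p v + q v) ^ 2 ≥ 4 e² / n`
by Cauchy–Schwarz. Together these say `(3 n² - 16 e) * (n² - 2 e) ≤ 0`. Hence on average a vertex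
reaches at least `11/16 * n > 49/72 * n` vertices, and the slack absorbs all error terms. The counts
only need that the number of edges between any two sets of vertices is about half the number of
pairs, which holds with high probability by Hoeffding's inequality and a union bound over all pairs
of sets.

For the upper bound, split the vertices into two halves, and give colour `0` to the edges inside the
halves and colour `1` to the edges between them. A monochromatic path of length two returns to the
half in which it starts, so a vertex reaches at most its own half and its out-neighbours in the
other half, of which there are about `n / 4`, for all vertices simultaneously by Hoeffding's
inequality.
-/

/-! ### Counting triangles in a digraph of small discrepancy -/

section Counting

variable {V : Type*} [Fintype V]

/-- The relation with `0/1`-matrix `a` has discrepancy at most `δ` from density `1/2`: between any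
two sets `A` and `B` it has `|A||B|/2 ± δ` ordered pairs. -/
def HasDiscrepancyLE (a : V → V → ℝ) (δ : ℝ) : Prop :=
  ∀ A B : Finset V, |∑ u ∈ A, ∑ v ∈ B, (a u v - 1 / 2)| ≤ δ

/-- The matrix `a` has entries `0` and `1` only. -/
def IsZeroOne (a : V → V → ℝ) : Prop := ∀ u v, a u v = 0 ∨ a u v = 1

lemma sum_rotate (f : V → V → V → ℝ) :
    ∑ x, ∑ y, ∑ z, f x y z = ∑ y, ∑ z, ∑ x, f x y z := by
  rw [Finset.sum_comm]
  exact Finset.sum_congr rfl fun _ _ => Finset.sum_comm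

lemma HasDiscrepancyLE.abs_weighted_sum_le {a : V → V → ℝ} {δ : ℝ} (h : HasDiscrepancyLE a δ)
    {f g : V → ℝ} (hf : ∀ v, f v = 0 ∨ f v = 1) (hg : ∀ v, g v = 0 ∨ g v = 1) :
    |∑ u, ∑ v, f u * g v * (a u v - 1 / 2)| ≤ δ := by
  classical
  convert h (Finset.univ.filter fun u => f u = 1) (Finset.univ.filter fun v => g v = 1) using 2
  rw [Finset.sum_filter]
  refine Finset.sum_congr rfl fun u _ => ?_
  rw [Finset.sum_filter]
  rcases hf u with hu | hu
  · simp [hu]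
  · rw [if_pos hu]
    refine Finset.sum_congr rfl fun v _ => ?_
    rcases hg v with hv | hv <;> simp [hu, hv]

/-- Counting lemma: for each `x`, the pairs `(y, z)` with `y` in one set and `z` in another, the
sets depending on `x`, form an `a`-edge half of the time. -/
lemma HasDiscrepancyLE.abs_triple_sum_sub_le {a : V → V → ℝ} {δ : ℝ} (h : HasDiscrepancyLE a δ)
    {F H : V → V → ℝ} (hF : IsZeroOne F) (hH : IsZeroOne H) :
    |∑ x, ∑ y, ∑ z, F x y * H x z * a y z - 1 / 2 * ∑ x, (∑ y, F x y) * ∑ z, H x z|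
      ≤ Fintype.card V * δ := by
  have e : ∑ x, ∑ y, ∑ z, F x y * H x z * a y z - 1 / 2 * ∑ x, (∑ y, F x y) * ∑ z, H x z
      = ∑ x, ∑ y, ∑ z, F x y * H x z * (a y z - 1 / 2) := by
    rw [Finset.mul_sum, ← Finset.sum_sub_distrib]
    refine Finset.sum_congr rfl fun x _ => ?_
    simp only [mul_sub, Finset.sum_sub_distrib]
    simp only [← Finset.sum_mul]
    rw [mul_comm (1 / 2 : ℝ), ← Finset.sum_mul_sum]
  rw [e]
  calc _ ≤ ∑ x : V, |∑ y, ∑ z, F x y * H x z * (a y z - 1 / 2)| := Finset.abs_sum_le_sum_abs _ _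
    _ ≤ ∑ _x : V, δ := Finset.sum_le_sum fun x _ => h.abs_weighted_sum_le (hF x) (hH x)
    _ = _ := by simp

variable {a g : V → V → ℝ} {δ : ℝ}

/-- If the subgraph `g` of `a` meets every cyclic triangle of `a`, then three times the number of
`g`-edges in cyclic triangles exceeds the number of triangles by at least twice the number of
pairs of consecutive `g`-edges. For one triangle with `j ≥ 1` edges in `g` this says that
`j - 1 ≥ 2/3 * (j choose 2)`. -/
lemma cyclic_triangle_count (ha : IsZeroOne a) (hg : IsZeroOne g) (hga : ∀ u v, g u v ≤ a u v)
    (hcover : ∀ x y z, a x y = 1 → a y z = 1 → a z x = 1 → g x y = 1 ∨ g y z = 1 ∨ g z x = 1) :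
    2 * ∑ y, ∑ z, ∑ x, g y z * g x y * a z x + ∑ x, ∑ y, ∑ z, a x y * a z x * a y z
      ≤ 3 * ∑ x, ∑ y, ∑ z, g x y * a z x * a y z := by
  have key : ∀ x y z, 2 / 3 * (g y z * g x y * a z x + g z x * g y z * a x y
        + g x y * g z x * a y z) + a x y * a z x * a y z
      ≤ g x y * a z x * a y z + g y z * a x y * a z x + g z x * a y z * a x y := by
    intro x y z
    have h1 := hga x y
    have h2 := hga y z
    have h3 := hga z x
    have h := hcover x y z
    rcases ha x y with p1 | p1 <;> rcases ha y z with p2 | p2 <;> rcases ha z x with p3 | p3 <;>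
    rcases hg x y with q1 | q1 <;> rcases hg y z with q2 | q2 <;> rcases hg z x with q3 | q3 <;>
    simp only [p1, p2, p3, q1, q2, q3] at h h1 h2 h3 ⊢ <;> revert h h1 h2 h3 <;> norm_num
  have hsum := Finset.sum_le_sum fun x (_ : x ∈ Finset.univ) =>
    Finset.sum_le_sum fun y (_ : y ∈ Finset.univ) =>
    Finset.sum_le_sum fun z (_ : z ∈ Finset.univ) => key x y z
  simp only [Finset.sum_add_distrib, ← Finset.mul_sum] at hsum
  have r1 := sum_rotate fun x y z => g y z * g x y * a z x
  have r2 := sum_rotate fun z x y => g z x * g y z * a x y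
  have r2' := sum_rotate fun y z x => g z x * g y z * a x y
  have r3 := sum_rotate fun z x y => g x y * g z x * a y z
  have s2 := sum_rotate fun x y z => g y z * a x y * a z x
  have s3 := sum_rotate fun z x y => g z x * a y z * a x y
  linarith

/-- In a transitive triangle `u → w → v` with `uv` in `g`, inclusion–exclusion for the two events
that `uw` and `wv` lie in `g`. -/
lemma transitive_triangle_count (hg : IsZeroOne g) (hga : ∀ u v, g u v ≤ a u v) :
    ∑ u, ∑ w, ∑ v, g u w * g u v * a w v + ∑ v, ∑ u, ∑ w, g u v * g w v * a u w
      ≤ ∑ u, ∑ w, ∑ v, a u w * g u v * a w v + ∑ w, ∑ u, ∑ v, g u w * g w v * a u v := by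
  have key : ∀ u w v, g u w * g u v * a w v + g u v * g w v * a u w
      ≤ a u w * g u v * a w v + g u w * g w v * a u v := by
    intro u w v
    have h0 : ∀ x y, 0 ≤ g x y := fun x y => by rcases hg x y with h | h <;> simp [h]
    have h1 := mul_nonneg (h0 u v)
      (mul_nonneg (sub_nonneg.2 (hga u w)) (sub_nonneg.2 (hga w v)))
    have h2 := mul_nonneg (mul_nonneg (h0 u w) (h0 w v)) (sub_nonneg.2 (hga u v))
    linarith
  have hsum := Finset.sum_le_sum fun u (_ : u ∈ Finset.univ) =>
    Finset.sum_le_sum fun w (_ : w ∈ Finset.univ) =>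
    Finset.sum_le_sum fun v (_ : v ∈ Finset.univ) => key u w v
  simp only [Finset.sum_add_distrib] at hsum
  have r1 := sum_rotate fun v u w => g u v * g w v * a u w
  have r2 := Finset.sum_comm (s := Finset.univ) (t := Finset.univ)
    (f := fun w u => ∑ v, g u w * g w v * a u v)
  linarith

/-- A set of edges meeting every cyclic triangle of a quasirandom tournament has asymptotically at
least the proportion `3/8` of all edges: if `δ` is small compared with `n²`, then the number `e` of
its edges cannot be much smaller than the root `3 n² / 16` of the left-hand side. -/
lemma cover_edge_count (ha : IsZeroOne a) (hg : IsZeroOne g) (hga : ∀ u v, g u v ≤ a u v)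
    (hcover : ∀ x y z, a x y = 1 → a y z = 1 → a z x = 1 → g x y = 1 ∨ g y z = 1 ∨ g z x = 1)
    (h : HasDiscrepancyLE a δ) :
    (3 * (Fintype.card V : ℝ) ^ 2 - 16 * ∑ u, ∑ v, g u v)
        * ((Fintype.card V : ℝ) ^ 2 - 2 * ∑ u, ∑ v, g u v)
      ≤ 270 * δ * (Fintype.card V : ℝ) ^ 2 := by
  set n : ℝ := ((Fintype.card V : ℕ) : ℝ) with hn
  set e := ∑ u, ∑ v, g u v with he
  set q : V → ℝ := fun u => ∑ v, g u v with hq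
  set p : V → ℝ := fun v => ∑ u, g u v with hp
  have hn0 : 0 ≤ n := Nat.cast_nonneg _
  have hg' : IsZeroOne fun u v => g v u := fun u v => hg v u
  have ha' : IsZeroOne fun u v => a v u := fun u v => ha v u
  have one : IsZeroOne fun _ _ : V => (1 : ℝ) := fun _ _ => Or.inr rfl
  have hpe : ∑ v, p v = e := by rw [he, Finset.sum_comm]
  have hone : ∑ _z : V, (1 : ℝ) = n := by simp [hn]
  -- the number of cyclic triangles
  have c0 := abs_le.1 (h.abs_triple_sum_sub_le ha ha')
  have c0' := abs_le.1 (h.abs_triple_sum_sub_le one ha')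
  have c0'' := abs_le.1 (h Finset.univ Finset.univ)
  have e0 : ∑ x, (∑ y, a x y) * ∑ z, a z x = ∑ y, ∑ z, ∑ x, 1 * a x y * a z x := by
    simp only [Finset.sum_mul_sum, one_mul]
    exact sum_rotate fun x y z => a x y * a z x
  have e0' : ∑ u, ∑ v, (a u v - 1 / 2) = ∑ x, ∑ z, a z x - n ^ 2 / 2 := by
    rw [Finset.sum_comm (f := fun x z => a z x)]
    simp only [Finset.sum_sub_distrib, Finset.sum_const, Finset.card_univ, nsmul_eq_mul, ← hn]
    ring
  rw [e0] at c0
  rw [e0'] at c0''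
  simp only [hone, ← Finset.mul_sum] at c0'
  -- cyclic triangles with a marked edge in `g`
  have c1 := abs_le.1 (h.abs_triple_sum_sub_le hg ha')
  have c1' := abs_le.1 (h.abs_triple_sum_sub_le one hg')
  have e1 : ∑ x, (∑ y, g x y) * ∑ z, a z x = ∑ y, ∑ z, ∑ x, 1 * g x y * a z x := by
    simp only [Finset.sum_mul_sum, one_mul]
    exact sum_rotate fun x y z => g x y * a z x
  rw [e1] at c1
  simp only [hone, ← Finset.mul_sum] at c1'
  -- cyclic triangles with two marked edges in `g`
  have c2 := abs_le.1 (h.abs_triple_sum_sub_le hg hg')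
  -- transitive triangles, with one or two marked edges in `g`
  have t1 := abs_le.1 (h.abs_triple_sum_sub_le ha hg)
  have t1' := abs_le.1 (h.abs_triple_sum_sub_le hg' one)
  have e2 : ∑ u, (∑ w, a u w) * ∑ v, g u v = ∑ v, ∑ u, ∑ w, g u v * 1 * a u w := by
    simp only [Finset.sum_mul_sum, mul_one]
    rw [← sum_rotate fun w v u => g u v * a u w, sum_rotate fun w v u => g u v * a u w,
      sum_rotate fun v u w => g u v * a u w]
    refine Finset.sum_congr rfl fun u _ => Finset.sum_congr rfl fun w _ =>
      Finset.sum_congr rfl fun v _ => mul_comm _ _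
  rw [e2] at t1
  simp only [hone, ← Finset.sum_mul] at t1'
  have t2 := abs_le.1 (h.abs_triple_sum_sub_le hg hg)
  have t3 := abs_le.1 (h.abs_triple_sum_sub_le hg' hg')
  have t4 := abs_le.1 (h.abs_triple_sum_sub_le hg' hg)
  have hcyc := cyclic_triangle_count ha hg hga hcover
  have htr := transitive_triangle_count hg hga
  have f2 : ∑ x, (∑ y, g x y) * ∑ z, g z x = ∑ x, p x * q x :=
    Finset.sum_congr rfl fun x _ => mul_comm _ _
  rw [f2] at c2
  change _ ≤ _ - 1 / 2 * ∑ x, q x * q x ∧ _ at t2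
  change _ ≤ _ - 1 / 2 * ∑ x, p x * p x ∧ _ at t3
  change _ ∧ _ - 1 / 2 * ∑ x, p x * q x ≤ _ at t4
  have fe : ∑ x, ∑ z, g z x = e := hpe
  rw [fe] at c1'
  rw [fe] at t1'
  rw [← hn] at c0 c0' c1 c1' c2 t1 t1' t2 t3 t4
  set W := ∑ x, p x * q x with hW
  have hsq : (2 * e) ^ 2 ≤ n * ∑ x, (p x + q x) ^ 2 := by
    have := sq_sum_le_card_mul_sum_sq (s := Finset.univ) (f := fun x => p x + q x)
    rwa [Finset.sum_add_distrib, hpe, show ∑ x, q x = e from rfl, ← two_mul,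
      Finset.card_univ, ← hn] at this
  have hexp : ∑ x, (p x + q x) ^ 2 = ∑ x, p x * p x + ∑ x, q x * q x + 2 * W := by
    rw [hW, Finset.mul_sum, ← Finset.sum_add_distrib, ← Finset.sum_add_distrib]
    exact Finset.sum_congr rfl fun x _ => by ring
  have hcnt : n * (n ^ 2 / 2 - δ) ≤ n * ∑ x, ∑ z, a z x :=
    mul_le_mul_of_nonneg_left (by linarith [c0''.1]) hn0
  have hI : (∑ x, p x * p x + ∑ x, q x * q x) / 2 ≤ W / 2 + e * n / 4 + 9 / 2 * (n * δ) := by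
    linarith [t1.2, t1'.2, t2.1, t3.1, t4.2]
  have hII : W ≤ 3 / 4 * (e * n) - n ^ 3 / 8 + 33 / 4 * (n * δ) := by
    linarith [c0.1, c0'.1, c1.2, c1'.2, c2.1]
  have hfin : n * ∑ x, (p x + q x) ^ 2
      ≤ n * (11 / 4 * (e * n) - 3 / 8 * n ^ 3 + 135 / 4 * (n * δ)) :=
    mul_le_mul_of_nonneg_left (by linarith) hn0
  linarith

end Counting

/-! ### Path-monochromatic arborescences of depth two -/

section Arborescences

variable {V : Type*} {T : Tournament V} {k : ℕ} {c : V → V → Fin k}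

/-- The function `par` describes an arborescence of depth at most two on `S` with root `r`: the
parent of each non-root is an in-neighbour, and it is either `r` or a child of `r` joined to `r`
in the colour of the edge below it. The value `par r` is irrelevant. -/
structure IsParentFunction (T : Tournament V) (c : V → V → Fin k) (S : Finset V) (r : V)
    (par : V → V) : Prop where
  root_mem : r ∈ S
  adj : ∀ v ∈ S, v ≠ r → T.Adj (par v) v
  depth : ∀ v ∈ S, v ≠ r → par v = r ∨
    (par v ∈ S ∧ par v ≠ r ∧ par (par v) = r ∧ c r (par v) = c (par v) v)

/-- The edges from parents to children. -/
def parentDigraph (S : Finset V) (r : V) (par : V → V) : Digraph V where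
  Adj u v := v ∈ S ∧ v ≠ r ∧ u = par v

namespace IsParentFunction

variable {S : Finset V} {r : V} {par : V → V}

lemma parent_mem (h : IsParentFunction T c S r par) {v : V} (hv : v ∈ S) (hvr : v ≠ r) :
    par v ∈ S := by
  rcases h.depth v hv hvr with e | e
  · rw [e]; exact h.root_mem
  · exact e.1

lemma parent_ne (h : IsParentFunction T c S r par) {v : V} (hv : v ∈ S) (hvr : v ≠ r) :
    par v ≠ v := fun e => T.loopless v (by simpa [e] using h.adj v hv hvr)

lemma isTree (h : IsParentFunction T c S r par) :
    ((SimpleGraph.fromRel (parentDigraph S r par).Adj).induce (S : Set V)).IsTree := by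
  classical
  set G := (SimpleGraph.fromRel (parentDigraph S r par).Adj).induce (S : Set V) with hG
  have hadj : ∀ v (hv : v ∈ S) (hvr : v ≠ r),
      G.Adj ⟨par v, h.parent_mem hv hvr⟩ ⟨v, hv⟩ := fun v hv hvr =>
    ⟨h.parent_ne hv hvr, Or.inl ⟨hv, hvr, rfl⟩⟩
  have hreach : ∀ v (hv : v ∈ S), G.Reachable ⟨r, h.root_mem⟩ ⟨v, hv⟩ := by
    intro v hv
    by_cases hvr : v = r
    · subst hvr; rfl
    have h1 := (hadj v hv hvr).reachable
    rcases h.depth v hv hvr with e | ⟨hu, hur, e, -⟩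
    · simpa [e] using h1
    · have h2 := (hadj _ hu hur).reachable
      simp only [e] at h2
      exact h2.trans h1
  have hconn : G.Connected :=
    { preconnected := fun x y => (hreach x.1 x.2).symm.trans (hreach y.1 y.2)
      nonempty := ⟨⟨r, h.root_mem⟩⟩ }
  -- a connected graph is a tree as soon as its edges are at most as many as the non-root vertices
  refine SimpleGraph.isTree_iff_connected_and_card.2 ⟨hconn, ?_⟩
  refine le_antisymm ?_ hconn.card_vert_le_card_edgeSet_add_one
  have hle : Nat.card G.edgeSet ≤ Nat.card {v : (S : Set V) // v ≠ ⟨r, h.root_mem⟩} := by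
    refine Nat.card_le_card_of_surjective
      (fun v => ⟨s(⟨par v.1.1, h.parent_mem v.1.2 fun e => v.2 (Subtype.ext e)⟩, v.1),
        hadj v.1.1 v.1.2 fun e => v.2 (Subtype.ext e)⟩) ?_
    rintro ⟨e, he⟩
    induction e using Sym2.ind with
    | _ x y =>
      rcases he with ⟨-, ⟨hy, hyr, e⟩ | ⟨hx, hxr, e⟩⟩
      · exact ⟨⟨y, fun e' => hyr (congrArg Subtype.val e')⟩,
          Subtype.ext (Sym2.eq_iff.2 (Or.inl ⟨Subtype.ext e.symm, rfl⟩))⟩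
      · exact ⟨⟨x, fun e' => hxr (congrArg Subtype.val e')⟩,
          Subtype.ext (Sym2.eq_iff.2 (Or.inr ⟨Subtype.ext e.symm, rfl⟩))⟩
  have hcard : Nat.card {v : (S : Set V) // v ≠ ⟨r, h.root_mem⟩} + 1 = Nat.card (S : Set V) := by
    have : 0 < S.card := Finset.card_pos.2 ⟨r, h.root_mem⟩
    simp only [Nat.card_eq_fintype_card, ne_eq, Fintype.card_subtype_compl,
      Fintype.card_subtype_eq]
    simp
    omega
  omega

/-- The arborescence formed by the edges from parents to children. -/
def toArborescence (h : IsParentFunction T c S r par) : Arborescence T where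
  verts := S
  edges := parentDigraph S r par
  root := r
  root_mem := h.root_mem
  adj_of_edge := by
    rintro u v ⟨hv, hvr, rfl⟩
    exact h.adj v hv hvr
  mem_of_edge := by
    rintro u v ⟨hv, hvr, rfl⟩
    exact ⟨h.parent_mem hv hvr, hv⟩
  isTree := h.isTree
  reach := by
    intro v hv
    by_cases hvr : v = r
    · exact ⟨[r], by simp [IsDirPath], rfl, by simp [hvr]⟩
    have hpv := h.parent_ne hv hvr
    rcases h.depth v hv hvr with e | ⟨hu, hur, e, -⟩
    · exact ⟨[r, v], by simp [IsDirPath, parentDigraph, hv, hvr, e, Ne.symm hvr], rfl, rfl⟩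
    · exact ⟨[r, par v, v], by
        simp [IsDirPath, parentDigraph, hv, hvr, hu, hur, e, hpv, Ne.symm hvr, Ne.symm hur],
        rfl, rfl⟩

/-- If two edges follow each other, the first one starts at the root. So a directed path has at most
two edges, and if it has two, they form a path from the root. -/
lemma isDirPath_cases (h : IsParentFunction T c S r par) {p : List V}
    (hp : IsDirPath (parentDigraph S r par) p) :
    (∃ x, p = [x]) ∨ (∃ x y, p = [x, y]) ∨ (∃ x y z, p = [x, y, z] ∧ c x y = c y z) := by
  have key : ∀ {x y z}, (parentDigraph S r par).Adj x y → (parentDigraph S r par).Adj y z →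
      x = r ∧ c x y = c y z := by
    rintro x y z ⟨hy, hyr, rfl⟩ ⟨hz, hzr, rfl⟩
    obtain ⟨-, -, e, e'⟩ := (h.depth z hz hzr).resolve_left hyr
    exact ⟨e, by rw [e, e']⟩
  obtain ⟨hne, -, hch⟩ := hp
  match p, hne, hch with
  | [x], _, _ => exact Or.inl ⟨x, rfl⟩
  | [x, y], _, _ => exact Or.inr (Or.inl ⟨x, y, rfl⟩)
  | [x, y, z], _, hch =>
    simp only [List.isChain_cons_cons] at hch
    exact Or.inr (Or.inr ⟨x, y, z, rfl, (key hch.1 hch.2.1).2⟩)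
  | x :: y :: z :: w :: l, _, hch =>
    simp only [List.isChain_cons_cons] at hch
    exact absurd (key hch.2.1 hch.2.2.1).1 hch.1.2.1

lemma toArborescence_pathMonochromatic [NeZero k] (h : IsParentFunction T c S r par) :
    h.toArborescence.PathMonochromatic c := by
  intro p hp
  rcases h.isDirPath_cases hp with ⟨x, rfl⟩ | ⟨x, y, rfl⟩ | ⟨x, y, z, rfl, e⟩
  · exact ⟨0, by simp⟩
  · exact ⟨c x y, by simp⟩
  · exact ⟨c x y, by simp [e]⟩

lemma toArborescence_depthLE (h : IsParentFunction T c S r par) :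
    h.toArborescence.DepthLE 2 := by
  intro p hp
  rcases h.isDirPath_cases hp with ⟨x, rfl⟩ | ⟨x, y, rfl⟩ | ⟨x, y, z, rfl, e⟩ <;> simp

end IsParentFunction

/-- The vertex `w` is reached from `v` by a monochromatic directed path of length one or two. -/
def MonoReach (T : Tournament V) (c : V → V → Fin k) (v w : V) : Prop :=
  T.Adj v w ∨ ∃ u, T.Adj v u ∧ T.Adj u w ∧ c v u = c u w

/-- From every vertex there is a path-monochromatic arborescence of depth at most two on all
vertices that it reaches by monochromatic paths of length at most two. -/
lemma exists_arborescence [Fintype V] [NeZero k] (T : Tournament V) (c : V → V → Fin k) (r : V) :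
    ∃ A : Arborescence T, A.PathMonochromatic c ∧ A.DepthLE 2 ∧
      ∀ w, w = r ∨ MonoReach T c r w → w ∈ A.verts := by
  classical
  let S : Finset V := Finset.univ.filter fun w => w = r ∨ MonoReach T c r w
  have hmid : ∀ w, ∃ u, MonoReach T c r w → ¬ T.Adj r w →
      T.Adj r u ∧ T.Adj u w ∧ c r u = c u w := by
    intro w
    by_cases hw : MonoReach T c r w ∧ ¬ T.Adj r w
    · obtain ⟨u, hu⟩ := hw.1.resolve_left hw.2
      exact ⟨u, fun _ _ => hu⟩
    · exact ⟨w, fun h1 h2 => absurd ⟨h1, h2⟩ hw⟩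
  choose mid hmid using hmid
  let par : V → V := fun w => if T.Adj r w then r else mid w
  have hpar : IsParentFunction T c S r par :=
    { root_mem := by simp [S]
      adj := by
        intro w hw hwr
        have hw' : MonoReach T c r w := ((Finset.mem_filter.1 hw).2).resolve_left hwr
        by_cases ha : T.Adj r w
        · simp [par, ha]
        · simpa [par, ha] using (hmid w hw' ha).2.1
      depth := by
        intro w hw hwr
        have hw' : MonoReach T c r w := ((Finset.mem_filter.1 hw).2).resolve_left hwr
        by_cases ha : T.Adj r w
        · exact Or.inl (by simp [par, ha])
        · obtain ⟨h1, h2, h3⟩ := hmid w hw' ha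
          have hne : mid w ≠ r := fun e => T.loopless r (e ▸ h1)
          refine Or.inr ?_
          have e : par w = mid w := by simp [par, ha]
          rw [e]
          exact ⟨Finset.mem_filter.2 ⟨Finset.mem_univ _, Or.inr (Or.inl h1)⟩, hne,
            by simp [par, h1], h3⟩ }
  exact ⟨hpar.toArborescence, hpar.toArborescence_pathMonochromatic,
    hpar.toArborescence_depthLE, fun w hw => Finset.mem_filter.2 ⟨Finset.mem_univ _, hw⟩⟩

/-- A path-monochromatic arborescence of depth at most two only contains vertices that its root
reaches by monochromatic paths of length at most two. -/
lemma Arborescence.eq_root_or_monoReach (A : Arborescence T) (hm : A.PathMonochromatic c)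
    (hd : A.DepthLE 2) {w : V} (hw : w ∈ A.verts) : w = A.root ∨ MonoReach T c A.root w := by
  obtain ⟨p, hp, hh, hl⟩ := A.reach w hw
  obtain ⟨a, ha⟩ := hm p hp
  have hlen := hd p hp
  obtain ⟨-, -, hch⟩ := hp
  match p, hh, hl, ha, hlen, hch with
  | [x], hh, hl, _, _, _ =>
    simp only [List.head?_cons, List.getLast?_singleton, Option.some.injEq] at hh hl
    exact Or.inl (hl.symm.trans hh)
  | [x, y], hh, hl, _, _, hch =>
    simp at hh hl hch
    subst hh hl
    exact Or.inr (Or.inl (A.adj_of_edge _ _ hch))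
  | [x, y, z], hh, hl, ha, _, hch =>
    simp at hh hl hch ha
    subst hh hl
    exact Or.inr (Or.inr ⟨y, A.adj_of_edge _ _ hch.1, A.adj_of_edge _ _ hch.2,
      ha.1.trans ha.2.symm⟩)
  | x :: y :: z :: t :: l, _, _, _, hlen, _ =>
    simp at hlen

lemma le_maxArborescence [Fintype V] {l m : ℕ} (hk : 0 < k)
    (h : ∀ c : V → V → Fin k, ∃ A : Arborescence T, A.PathMonochromatic c ∧ A.DepthLE l ∧
      m ≤ A.verts.card) : m ≤ maxArborescence T k l := by
  refine le_csSup ⟨Fintype.card V, ?_⟩ h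
  intro m' hm'
  obtain ⟨A, -, -, hA⟩ := hm' fun _ _ => ⟨0, hk⟩
  exact hA.trans (Finset.card_le_univ _)

lemma maxArborescence_le {l : ℕ} (c : V → V → Fin k) {m : ℕ}
    (h : ∀ A : Arborescence T, A.PathMonochromatic c → A.DepthLE l → A.verts.card ≤ m) :
    maxArborescence T k l ≤ m := by
  refine csSup_le' fun m' hm' => ?_
  obtain ⟨A, h1, h2, h3⟩ := hm' c
  exact h3.trans (h A h1 h2)

end Arborescences

/-! ### Concentration of the number of edges between two sets -/

section Concentration

open ProbabilityTheory
open scoped NNReal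

/-- The sign `±1` of a coin flip. -/
def coinSign (b : Bool) : ℝ := if b then 1 else -1

lemma hasSubgaussianMGF_coinSign : HasSubgaussianMGF coinSign 1 fairCoin := by
  have hint : ∫ b, coinSign b ∂fairCoin = 0 := by
    rw [integral_fintype (Integrable.of_finite)]
    simp [fairCoin, coinSign, measureReal_def]
  have h := hasSubgaussianMGF_of_mem_Icc_of_integral_eq_zero (μ := fairCoin) (X := coinSign)
    (a := -1) (b := 1) (measurable_of_finite _).aemeasurable
    (ae_of_all _ fun b => by cases b <;> simp [coinSign]) hint
  convert h using 1
  ext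
  norm_num

/-- Hoeffding's inequality for weighted sums of fair signs. -/
lemma measureReal_sum_coinSign_ge_le {ι : Type*} [Fintype ι] (c : ι → ℝ) {K l : ℝ}
    (hK : ∑ i, c i ^ 2 ≤ K) (hl : 0 ≤ l) :
    (Measure.pi fun _ : ι => fairCoin).real {ω | l ≤ ∑ i, c i * coinSign (ω i)}
      ≤ Real.exp (-l ^ 2 / (2 * K)) := by
  have hK0 : 0 ≤ K := (Finset.sum_nonneg fun i _ => sq_nonneg (c i)).trans hK
  have hind : iIndepFun (fun (i : ι) (ω : ι → Bool) => c i * coinSign (ω i))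
      (Measure.pi fun _ : ι => fairCoin) :=
    iIndepFun_pi (X := fun i b => c i * coinSign b) fun i => (measurable_of_finite _).aemeasurable
  have hsub : ∀ i ∈ Finset.univ, HasSubgaussianMGF (fun ω : ι → Bool => c i * coinSign (ω i))
      (c i ^ 2).toNNReal (Measure.pi fun _ : ι => fairCoin) := by
    intro i _
    have h : HasSubgaussianMGF (coinSign ∘ Function.eval i) 1
        (Measure.pi fun _ : ι => fairCoin) := by
      refine HasSubgaussianMGF.of_map (measurable_pi_apply i).aemeasurable ?_
      rw [(measurePreserving_eval (fun _ : ι => fairCoin) i).map_eq]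
      exact hasSubgaussianMGF_coinSign
    convert h.const_mul (c i) using 1
    · rfl
    · exact (Real.toNNReal_of_nonneg (sq_nonneg _)).trans (mul_one _).symm
  have hsum := HasSubgaussianMGF.sum_of_iIndepFun hind hsub
  have hsumK : HasSubgaussianMGF (fun ω : ι → Bool => ∑ i, c i * coinSign (ω i)) K.toNNReal
      (Measure.pi fun _ : ι => fairCoin) := by
    refine ⟨hsum.integrable_exp_mul, fun t => (hsum.mgf_le t).trans (Real.exp_le_exp.2 ?_)⟩
    have hle : ((∑ i, (c i ^ 2).toNNReal : ℝ≥0) : ℝ) ≤ (K.toNNReal : ℝ) := by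
      rw [NNReal.coe_sum, Real.coe_toNNReal K hK0]
      exact (Finset.sum_congr rfl fun i _ => Real.coe_toNNReal _ (sq_nonneg _)).trans_le hK
    have := mul_le_mul_of_nonneg_right hle (sq_nonneg t)
    exact div_le_div_of_nonneg_right this two_pos.le
  simpa [Real.coe_toNNReal K hK0] using hsumK.measure_ge_le hl

open Classical in
/-- The adjacency matrix of a tournament. -/
noncomputable def Tournament.arc {V : Type*} (T : Tournament V) (u v : V) : ℝ :=
  if T.Adj u v then 1 else 0

lemma sum_sum_eq_sum_vertexPair {n : ℕ} (h : Fin n → Fin n → ℝ) :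
    ∑ u, ∑ v, h u v = ∑ e : VertexPair n, (h e.1.1 e.1.2 + h e.1.2 e.1.1) + ∑ u, h u u := by
  have h1 : ∑ e : VertexPair n, (h e.1.1 e.1.2 + h e.1.2 e.1.1)
      = ∑ u, ∑ v, if u < v then h u v + h v u else 0 := by
    rw [← Fintype.sum_prod_type' (f := fun u v : Fin n => if u < v then h u v + h v u else 0),
      ← Finset.sum_filter]
    exact (Finset.sum_subtype (Finset.univ.filter fun e : Fin n × Fin n => e.1 < e.2)
      (fun e => by simp) fun e => h e.1 e.2 + h e.2 e.1).symm
  have h2 : ∑ u, ∑ v, (if u < v then h u v + h v u else 0)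
      = ∑ u, ∑ v, ((if u < v then h u v else 0) + if v < u then h u v else 0) := by
    simp only [Finset.sum_add_distrib]
    rw [Finset.sum_comm (f := fun u v => if v < u then h u v else 0)]
    simp only [← Finset.sum_add_distrib]
    refine Finset.sum_congr rfl fun u _ => Finset.sum_congr rfl fun v _ => ?_
    split_ifs <;> simp
  rw [h1, h2, ← Finset.sum_add_distrib]
  refine Finset.sum_congr rfl fun u _ => ?_
  have h3 : h u u = ∑ v, if v = u then h u v else 0 := by simp
  rw [h3, ← Finset.sum_add_distrib]
  refine Finset.sum_congr rfl fun v _ => ?_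
  rcases lt_trichotomy u v with hlt | rfl | hlt
  · simp [hlt, hlt.not_gt, hlt.ne']
  · simp
  · simp [hlt, hlt.not_gt, hlt.ne]

variable {n : ℕ}

/-- The coefficient with which the coin of a pair contributes to the number of edges from `A` to
`B`. -/
def pairCoeff (A B : Finset (Fin n)) (e : VertexPair n) : ℝ :=
  (if e.1.1 ∈ A ∧ e.1.2 ∈ B then 1 else 0) - if e.1.2 ∈ A ∧ e.1.1 ∈ B then 1 else 0

lemma sum_mem_eq_sum_ite (A B : Finset (Fin n)) (h : Fin n → Fin n → ℝ) :
    ∑ u ∈ A, ∑ v ∈ B, h u v = ∑ u, ∑ v, if u ∈ A ∧ v ∈ B then h u v else 0 := by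
  have h1 : ∀ u, (∑ v, if u ∈ A ∧ v ∈ B then h u v else 0)
      = if u ∈ A then ∑ v ∈ B, h u v else 0 := by
    intro u
    by_cases hu : u ∈ A <;> simp [hu]
  simp [h1]

lemma sum_pairCoeff_sq_le (A B : Finset (Fin n)) :
    ∑ e, pairCoeff A B e ^ 2 ≤ A.card * B.card := by
  have h := sum_sum_eq_sum_vertexPair fun u v : Fin n => if u ∈ A ∧ v ∈ B then (1 : ℝ) else 0
  rw [← sum_mem_eq_sum_ite A B fun _ _ => 1] at h
  have h0 : 0 ≤ ∑ u, if u ∈ A ∧ u ∈ B then (1 : ℝ) else 0 :=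
    Finset.sum_nonneg fun u _ => by positivity
  have h1 : ∑ e, pairCoeff A B e ^ 2 ≤ ∑ e : VertexPair n,
      ((if e.1.1 ∈ A ∧ e.1.2 ∈ B then (1 : ℝ) else 0) +
        if e.1.2 ∈ A ∧ e.1.1 ∈ B then (1 : ℝ) else 0) := by
    refine Finset.sum_le_sum fun e _ => ?_
    unfold pairCoeff
    split_ifs <;> norm_num
  simp at h
  linarith

lemma sum_arc_ofCoins (A B : Finset (Fin n)) (ω : VertexPair n → Bool) :
    ∑ u ∈ A, ∑ v ∈ B, ((Tournament.ofCoins ω).arc u v - 1 / 2)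
      = (∑ e, pairCoeff A B e * coinSign (ω e)) / 2 - (A ∩ B).card / 2 := by
  rw [sum_mem_eq_sum_ite, sum_sum_eq_sum_vertexPair, Finset.sum_div]
  rw [sub_eq_add_neg]
  congr 1
  · refine Finset.sum_congr rfl fun e _ => ?_
    have h1 : (Tournament.ofCoins ω).arc e.1.1 e.1.2 - 1 / 2 = coinSign (ω e) / 2 := by
      have := e.2
      cases h : ω e <;> simp [Tournament.arc, Tournament.ofCoins, coinSign, h, this.not_gt, this] <;>
        norm_num
    have h2 : (Tournament.ofCoins ω).arc e.1.2 e.1.1 - 1 / 2 = -coinSign (ω e) / 2 := by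
      have := e.2
      cases h : ω e <;> simp [Tournament.arc, Tournament.ofCoins, coinSign, h, this.not_gt, this] <;>
        norm_num
    rw [h1, h2]
    unfold pairCoeff
    split_ifs <;> ring
  · have h : ∀ u : Fin n, (Tournament.ofCoins ω).arc u u = 0 := fun u =>
      if_neg ((Tournament.ofCoins ω).loopless u)
    simp only [h, ← Finset.mem_inter, Finset.sum_ite_mem, Finset.univ_inter, Finset.sum_const,
      nsmul_eq_mul]
    ring

lemma randomTournament_real (S : Set (Tournament (Fin n))) :
    (randomTournament n).real S
      = (Measure.pi fun _ : VertexPair n => fairCoin).real (Tournament.ofCoins ⁻¹' S) :=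
  map_measureReal_apply (measurable_of_finite _) trivial

/-- Upper tail of the number of edges from `A` to `B`. -/
lemma randomTournament_upper_tail (A B : Finset (Fin n)) {K l : ℝ}
    (hK : (A.card : ℝ) * B.card ≤ K) (hl : 0 ≤ l) :
    (randomTournament n).real {T | l ≤ ∑ u ∈ A, ∑ v ∈ B, (T.arc u v - 1 / 2)}
      ≤ Real.exp (-(2 * l ^ 2) / K) := by
  rw [randomTournament_real]
  refine (measureReal_mono ?_).trans ((measureReal_sum_coinSign_ge_le (pairCoeff A B)
    ((sum_pairCoeff_sq_le A B).trans hK) (l := 2 * l) (by positivity)).trans_eq ?_)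
  · intro ω hω
    simp only [Set.mem_preimage, Set.mem_ofPred_eq, sum_arc_ofCoins] at hω ⊢
    have : (0 : ℝ) ≤ (A ∩ B).card := Nat.cast_nonneg _
    linarith
  · congr 1
    rw [show -(2 * l) ^ 2 = 2 * -(2 * l ^ 2) by ring, mul_div_mul_left _ _ two_ne_zero]

/-- Lower tail of the number of edges from `A` to `B`; the summand `n / 2` accounts for the pairs
`(u, u)`, which are not edges. -/
lemma randomTournament_lower_tail (A B : Finset (Fin n)) {K l : ℝ}
    (hK : (A.card : ℝ) * B.card ≤ K) (hl : 0 ≤ l) :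
    (randomTournament n).real {T | l + n / 2 ≤ -∑ u ∈ A, ∑ v ∈ B, (T.arc u v - 1 / 2)}
      ≤ Real.exp (-(2 * l ^ 2) / K) := by
  rw [randomTournament_real]
  refine (measureReal_mono ?_).trans ((measureReal_sum_coinSign_ge_le (fun e => -pairCoeff A B e)
    (K := K) (by simpa using (sum_pairCoeff_sq_le A B).trans hK) (l := 2 * l)
    (by positivity)).trans_eq ?_)
  · intro ω hω
    simp only [Set.mem_preimage, Set.mem_ofPred_eq, sum_arc_ofCoins] at hω ⊢
    have : ((A ∩ B).card : ℝ) ≤ n := by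
      exact_mod_cast (Finset.card_le_univ (A ∩ B)).trans_eq (Fintype.card_fin n)
    simp only [neg_mul, Finset.sum_neg_distrib]
    linarith
  · congr 1
    rw [show -(2 * l) ^ 2 = 2 * -(2 * l ^ 2) by ring, mul_div_mul_left _ _ two_ne_zero]

/-- Events whose complements lie in events of vanishing probability have probability tending to
one. -/
lemma tendsto_one_of_compl_le {α : ℕ → Type*} [∀ n, MeasurableSpace (α n)]
    {μ : ∀ n, Measure (α n)} [∀ n, IsProbabilityMeasure (μ n)] {S B : ∀ n, Set (α n)}
    (hB : ∀ n, MeasurableSet (B n)) {b : ℕ → ℝ}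
    (hS : ∀ᶠ n in atTop, (B n)ᶜ ⊆ S n) (hb : ∀ᶠ n in atTop, (μ n).real (B n) ≤ b n)
    (hb0 : Tendsto b atTop (𝓝 0)) : Tendsto (fun n => μ n (S n)) atTop (𝓝 1) := by
  have h1 : Tendsto (fun n => ENNReal.ofReal (1 - b n)) atTop (𝓝 1) := by
    have := ENNReal.tendsto_ofReal (hb0.const_sub 1)
    simpa using this
  refine tendsto_of_tendsto_of_tendsto_of_le_of_le' h1 tendsto_const_nhds ?_
    (Eventually.of_forall fun n => prob_le_one)
  filter_upwards [hS, hb] with n hSn hbn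
  refine le_trans ?_ (measure_mono hSn)
  rw [← ofReal_measureReal, probReal_compl_eq_one_sub (hB n)]
  exact ENNReal.ofReal_le_ofReal (by linarith)

end Concentration

/-! ### The lower bound -/

section LowerBound

variable {V : Type*} [Fintype V]

open Classical in
/-- In a quasirandom tournament, every colouring with two colours has a vertex that reaches many
vertices. The value `1 / 10000` is small enough for the slack between `11/16` and `49/72`. -/
lemma maxArborescence_ge_of_hasDiscrepancyLE {T : Tournament V}
    (hV : 0 < Fintype.card V)
    (h : HasDiscrepancyLE T.arc (1 / 10000 * (Fintype.card V : ℝ) ^ 2)) :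
    49 / 72 * (Fintype.card V : ℝ) ≤ maxArborescence T 2 2 := by
  have hn : (0 : ℝ) < (Fintype.card V : ℝ) := by exact_mod_cast hV
  refine (Nat.le_ceil _).trans (Nat.cast_le.2 (le_maxArborescence two_pos fun c => ?_))
  choose A hA1 hA2 hA3 using exists_arborescence T c
  by_contra! hcon
  replace hcon : ∀ r, ((A r).verts.card : ℝ) < 49 / 72 * Fintype.card V := fun r =>
    Nat.lt_ceil.1 (hcon (A r) (hA1 r) (hA2 r))
  -- the edges along which one can return by a monochromatic path of length two
  let g : V → V → ℝ := fun u v => if T.Adj u v ∧ MonoReach T c v u then 1 else 0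
  have ha : IsZeroOne T.arc := fun u v => by
    by_cases huv : T.Adj u v <;> simp [Tournament.arc, huv]
  have hg : IsZeroOne g := fun u v => by
    by_cases huv : T.Adj u v ∧ MonoReach T c v u <;> simp [g, huv]
  have hga : ∀ u v, g u v ≤ T.arc u v := fun u v => by
    by_cases huv : T.Adj u v <;> by_cases hr : MonoReach T c v u <;>
      simp [g, Tournament.arc, huv, hr]
  have hcover : ∀ x y z, T.arc x y = 1 → T.arc y z = 1 → T.arc z x = 1 →
      g x y = 1 ∨ g y z = 1 ∨ g z x = 1 := by
    intro x y z h1 h2 h3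
    simp only [Tournament.arc, ite_eq_left_iff, zero_ne_one, imp_false, not_not] at h1 h2 h3
    simp only [g, ite_eq_left_iff, zero_ne_one, imp_false, not_not]
    -- two of the three edges of the triangle have the same colour
    have hpig : ∀ a b d : Fin 2, b = d ∨ d = a ∨ a = b := by decide
    rcases hpig (c x y) (c y z) (c z x) with e | e | e
    · exact Or.inl ⟨h1, Or.inr ⟨z, h2, h3, e⟩⟩
    · exact Or.inr (Or.inl ⟨h2, Or.inr ⟨x, h3, h1, e⟩⟩)
    · exact Or.inr (Or.inr ⟨h3, Or.inr ⟨y, h1, h2, e⟩⟩)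
  have hcount := cover_edge_count ha hg hga hcover h
  have hdisc := (abs_le.1 (h Finset.univ Finset.univ)).2
  -- a vertex `w` outside the arborescence of `v` gives an edge `w → v` that is not in `g`
  have hpt : ∀ v w, 1 ≤ (if w ∈ (A v).verts then (1 : ℝ) else 0) + (T.arc w v - g w v) := by
    intro v w
    by_cases hw : w ∈ (A v).verts
    · simpa [hw] using hga w v
    · have hw' := mt (hA3 v w) hw
      push Not at hw'
      have hadj : T.Adj w v := (T.adj_iff_not_adj w v hw'.1).2 fun h' => hw'.2 (Or.inl h')
      simp [hw, g, Tournament.arc, hadj, hw'.2]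
  have hsum := Finset.sum_le_sum fun v (_ : v ∈ Finset.univ) =>
    Finset.sum_le_sum fun w (_ : w ∈ Finset.univ) => hpt v w
  have hverts : ∑ v, ((A v).verts.card : ℝ) ≤ ∑ _v : V, 49 / 72 * (Fintype.card V : ℝ) :=
    Finset.sum_le_sum fun v _ => (hcon v).le
  simp only [Finset.sum_add_distrib, Finset.sum_sub_distrib, Finset.sum_ite_mem,
    Finset.univ_inter, Finset.sum_const, Finset.card_univ, nsmul_eq_mul, mul_one]
    at hsum hverts hdisc
  rw [Finset.sum_comm (f := fun v w => T.arc w v), Finset.sum_comm (f := fun v w => g w v)] at hsum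
  set n : ℝ := ((Fintype.card V : ℕ) : ℝ)
  set e := ∑ u, ∑ v, g u v
  have he : e ≤ (13 / 72 + 1 / 10000) * n ^ 2 := by nlinarith
  have hn2 : 0 < n ^ 2 := by positivity
  -- the two factors in `hcount` are about `n² / 9` and `23 n² / 36`
  have h1 : 1 / 10 * n ^ 2 ≤ 3 * n ^ 2 - 16 * e := by linarith
  have h2 : 6 / 10 * n ^ 2 ≤ n ^ 2 - 2 * e := by linarith
  have h3 := mul_le_mul h1 h2 (by positivity) (by linarith [hn2.le])
  nlinarith [mul_pos hn2 hn2]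

/-- Almost all tournaments are quasirandom. -/
lemma randomTournament_not_hasDiscrepancyLE {ε : ℝ} (hε : 0 < ε) {n : ℕ} (hn : 1 ≤ ε * n) :
    (randomTournament n).real {T | ¬ HasDiscrepancyLE T.arc (ε * (n : ℝ) ^ 2)}
      ≤ 4 ^ n * (2 * Real.exp (-(ε ^ 2 * n ^ 2 / 2))) := by
  have hn0 : (0 : ℝ) < n := by
    by_contra! h
    nlinarith
  set l : ℝ := ε * n ^ 2 / 2 with hl
  have hl0 : 0 ≤ l := by positivity
  have hln : l + n / 2 ≤ ε * n ^ 2 := by nlinarith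
  have hexp : -(2 * l ^ 2) / (n : ℝ) ^ 2 = -(ε ^ 2 * n ^ 2 / 2) := by
    rw [hl]
    field_simp
  let E : Finset (Fin n) × Finset (Fin n) → Set (Tournament (Fin n)) := fun P =>
    {T | l ≤ ∑ u ∈ P.1, ∑ v ∈ P.2, (T.arc u v - 1 / 2)} ∪
      {T | l + n / 2 ≤ -∑ u ∈ P.1, ∑ v ∈ P.2, (T.arc u v - 1 / 2)}
  have hE : ∀ P, (randomTournament n).real (E P)
      ≤ 2 * Real.exp (-(ε ^ 2 * n ^ 2 / 2)) := by
    intro P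
    have hcard : ∀ S : Finset (Fin n), (S.card : ℝ) ≤ n := fun S => by
      exact_mod_cast (Finset.card_le_univ S).trans_eq (Fintype.card_fin n)
    have hK : (P.1.card : ℝ) * P.2.card ≤ (n : ℝ) ^ 2 := by
      rw [sq]
      exact mul_le_mul (hcard _) (hcard _) (Nat.cast_nonneg _) hn0.le
    refine (measureReal_union_le _ _).trans ?_
    have h1 := randomTournament_upper_tail P.1 P.2 hK hl0
    have h2 := randomTournament_lower_tail P.1 P.2 hK hl0
    rw [hexp] at h1 h2
    linarith
  have hsub : {T : Tournament (Fin n) | ¬ HasDiscrepancyLE T.arc (ε * (n : ℝ) ^ 2)} ⊆ ⋃ P, E P := by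
    intro T hT
    simp only [HasDiscrepancyLE, Set.mem_ofPred_eq] at hT
    push Not at hT
    obtain ⟨A, B, hAB⟩ := hT
    refine Set.mem_iUnion.2 ⟨(A, B), ?_⟩
    rcases lt_abs.1 hAB with h | h
    · exact Or.inl (by simp only [Set.mem_ofPred_eq]; linarith)
    · exact Or.inr (by simp only [Set.mem_ofPred_eq]; linarith)
  refine (measureReal_mono hsub).trans ((measureReal_iUnion_fintype_le _).trans
    ((Finset.sum_le_sum fun P _ => hE P).trans_eq ?_))
  simp only [Finset.sum_const, Finset.card_univ, Fintype.card_prod, Fintype.card_finset,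
    Fintype.card_fin, nsmul_eq_mul]
  push_cast
  rw [← mul_pow]
  norm_num

lemma tendsto_maxArborescence_ge :
    Tendsto (fun n : ℕ => randomTournament n
      {T | (49 / 72 : ℝ) * n ≤ maxArborescence T 2 2}) atTop (𝓝 1) := by
  refine tendsto_one_of_compl_le (b := fun n : ℕ => 2 * Real.exp (-(n : ℝ)))
    (B := fun n => {T | ¬ HasDiscrepancyLE T.arc (1 / 10000 * (n : ℝ) ^ 2)})
    (fun n => trivial) ?_ ?_ ?_
  · filter_upwards [eventually_gt_atTop 0] with n hn T hT
    have := maxArborescence_ge_of_hasDiscrepancyLE (T := T) (by simpa using hn)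
      (by simpa using hT)
    simpa using this
  · filter_upwards [eventually_ge_atTop 600000000] with n hn
    have hn' : (600000000 : ℝ) ≤ n := by exact_mod_cast hn
    refine (randomTournament_not_hasDiscrepancyLE (by norm_num) (by linarith)).trans ?_
    have h4 : (4 : ℝ) ^ n ≤ Real.exp (2 * n) := by
      rw [mul_comm, Real.exp_nat_mul]
      refine pow_le_pow_left₀ (by norm_num) ?_ n
      have := Real.add_one_le_exp (1 : ℝ)
      rw [show (2 : ℝ) = 1 + 1 by norm_num, Real.exp_add]
      nlinarith
    calc _ ≤ Real.exp (2 * n) * (2 * Real.exp (-((1 / 10000) ^ 2 * (n : ℝ) ^ 2 / 2))) := by gcongr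
      _ = 2 * Real.exp (2 * n + -((1 / 10000) ^ 2 * (n : ℝ) ^ 2 / 2)) := by
        rw [Real.exp_add]; ring
      _ ≤ _ := by
        gcongr
        nlinarith
  · have := (Real.tendsto_exp_neg_atTop_nhds_zero.comp tendsto_natCast_atTop_atTop).const_mul 2
    simpa [Function.comp_def] using this

end LowerBound

/-! ### The upper bound -/

section UpperBound

variable {n : ℕ}

/-- The two vertices lie in the same half of `Fin n`. -/
def SameHalf (u v : Fin n) : Prop := 2 * u.1 < n ↔ 2 * v.1 < n

open Classical in
/-- The colouring with colour `0` inside the two halves and colour `1` between them. -/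
noncomputable def halfColouring (u v : Fin n) : Fin 2 := if SameHalf u v then 0 else 1

open Classical in
/-- The vertices in the other half than `u`. -/
noncomputable def otherHalf (u : Fin n) : Finset (Fin n) :=
  Finset.univ.filter fun v => ¬ SameHalf u v

lemma card_otherHalf (u : Fin n) : (n : ℝ) - (n + 1) / 2 ≤ (otherHalf u).card := by
  have h1 : (Finset.univ.filter fun v : Fin n => 2 * v.1 < n).card = (n + 1) / 2 := by
    rw [Finset.filter_congr (q := fun v : Fin n => v.1 < (n + 1) / 2) fun v _ => by omega,
      Fin.card_filter_val_lt]
    omega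
  have h2 := Finset.card_filter_add_card_filter_not (s := (Finset.univ : Finset (Fin n)))
    (fun v => 2 * v.1 < n)
  rw [h1, Finset.card_univ, Fintype.card_fin] at h2
  have h3 : n ≤ 2 * (otherHalf u).card + 1 := by
    by_cases hu : 2 * u.1 < n
    · have : otherHalf u = Finset.univ.filter fun v : Fin n => ¬ 2 * v.1 < n := by
        ext v; simp [otherHalf, SameHalf, hu]
      rw [this]
      omega
    · have : otherHalf u = Finset.univ.filter fun v : Fin n => 2 * v.1 < n := by
        ext v; simp [otherHalf, SameHalf, hu]
      rw [this, h1]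
      omega
  have h4 : (n : ℝ) ≤ 2 * (otherHalf u).card + 1 := by exact_mod_cast h3
  linarith

/-- A monochromatic path of length two ends in the half in which it starts. -/
lemma sameHalf_of_monoReach {T : Tournament (Fin n)} {v w : Fin n}
    (h : MonoReach T halfColouring v w) : SameHalf v w ∨ T.Adj v w := by
  rcases h with h | ⟨u, -, -, h⟩
  · exact Or.inr h
  · left
    simp only [halfColouring, SameHalf] at h ⊢
    by_cases h1 : 2 * v.1 < n <;> by_cases h2 : 2 * u.1 < n <;> by_cases h3 : 2 * w.1 < n <;>
      simp only [h1, h2, h3] at h ⊢ <;> simp at h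

lemma maxArborescence_le_of_outdegree_le {T : Tournament (Fin n)} {l : ℝ}
    (h : ∀ u, ∑ v ∈ otherHalf u, (T.arc u v - 1 / 2) ≤ l) (hl : 0 ≤ l) :
    (maxArborescence T 2 2 : ℝ) ≤ 3 / 4 * n + (l + 1) := by
  classical
  have hpos : 0 ≤ 3 / 4 * (n : ℝ) + (l + 1) := by positivity
  refine le_trans (Nat.cast_le.2 (maxArborescence_le halfColouring fun A hm hd => ?_))
    (Nat.floor_le hpos)
  rw [Nat.le_floor_iff hpos]
  set r := A.root
  have hsub : A.verts ⊆ (otherHalf r)ᶜ ∪ (otherHalf r).filter fun w => T.Adj r w := by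
    intro w hw
    by_cases hs : SameHalf r w
    · simp [otherHalf, hs]
    · have hadj : T.Adj r w := by
        rcases A.eq_root_or_monoReach hm hd hw with e | e
        · exact absurd (by rw [e]; exact Iff.rfl) hs
        · exact (sameHalf_of_monoReach e).resolve_left hs
      simp [otherHalf, hs, hadj]
  have hcard : (A.verts.card : ℝ) ≤ ((otherHalf r)ᶜ.card : ℝ) +
      ((otherHalf r).filter fun w => T.Adj r w).card := by
    exact_mod_cast (Finset.card_le_card hsub).trans (Finset.card_union_le _ _)
  have hcompl : ((otherHalf r)ᶜ.card : ℝ) + (otherHalf r).card = n := by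
    exact_mod_cast (Finset.card_compl_add_card _).trans (Fintype.card_fin n)
  have hout : (((otherHalf r).filter fun w => T.Adj r w).card : ℝ)
      = ∑ v ∈ otherHalf r, T.arc r v := by
    simp [Tournament.arc]
  have hr := h r
  simp only [Finset.sum_sub_distrib, Finset.sum_const, nsmul_eq_mul] at hr
  have := card_otherHalf r
  linarith

lemma tendsto_maxArborescence_le :
    Tendsto (fun n : ℕ => randomTournament n
      {T | (maxArborescence T 2 2 : ℝ) ≤ 3 / 4 * n + ((n : ℝ) ^ (3 / 4 : ℝ) + 1)}) atTop (𝓝 1) := by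
  let E : ∀ n : ℕ, Fin n → Set (Tournament (Fin n)) := fun n u =>
    {T | (n : ℝ) ^ (3 / 4 : ℝ) ≤ ∑ v ∈ otherHalf u, (T.arc u v - 1 / 2)}
  refine tendsto_one_of_compl_le (b := fun n : ℕ => √(n : ℝ) ^ 2 * Real.exp (-√(n : ℝ)))
    (B := fun n => ⋃ u, E n u) (fun n => trivial) ?_ ?_ ?_
  · refine Eventually.of_forall fun n T hT => ?_
    refine maxArborescence_le_of_outdegree_le (fun u => ?_) (by positivity)
    have : T ∉ E n u := fun h => hT (Set.mem_iUnion.2 ⟨u, h⟩)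
    exact (not_le.1 this).le
  · filter_upwards [eventually_gt_atTop 0] with n hn
    have hn0 : (0 : ℝ) < n := by exact_mod_cast hn
    have hexp : -(2 * ((n : ℝ) ^ (3 / 4 : ℝ)) ^ 2) / n = -(2 * √(n : ℝ)) := by
      have : ((n : ℝ) ^ (3 / 4 : ℝ)) ^ 2 = √(n : ℝ) * n := by
        rw [← Real.rpow_natCast, ← Real.rpow_mul hn0.le, Real.sqrt_eq_rpow]
        nth_rewrite 3 [← Real.rpow_one (n : ℝ)]
        rw [← Real.rpow_add hn0]
        norm_num
      rw [this]
      field_simp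
    have hE : ∀ u, (randomTournament n).real (E n u) ≤ Real.exp (-√(n : ℝ)) := by
      intro u
      have h := randomTournament_upper_tail {u} (otherHalf u) (K := n)
        (l := (n : ℝ) ^ (3 / 4 : ℝ)) (by
          simpa using (Finset.card_le_univ (otherHalf u)).trans_eq (Fintype.card_fin n))
        (by positivity)
      rw [hexp] at h
      simp only [Finset.sum_singleton] at h
      refine h.trans (Real.exp_le_exp.2 ?_)
      linarith [Real.sqrt_nonneg (n : ℝ)]
    refine (measureReal_iUnion_fintype_le _).trans
      ((Finset.sum_le_sum fun u _ => hE u).trans_eq ?_)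
    simp
  · exact (Real.tendsto_pow_mul_exp_neg_atTop_nhds_zero 2).comp
      (Real.tendsto_sqrt_atTop.comp tendsto_natCast_atTop_atTop)

end UpperBound

theorem theorem3 :
    (∃ g : ℕ → ℝ, g =o[atTop] (fun n : ℕ => (n : ℝ)) ∧
      Tendsto (fun n : ℕ => randomTournament n
        {T | (maxArborescence T 2 2 : ℝ) + g n ≥ (49 / 72 : ℝ) * n}) atTop (𝓝 1)) ∧
    (∃ g : ℕ → ℝ, g =o[atTop] (fun n : ℕ => (n : ℝ)) ∧
      Tendsto (fun n : ℕ => randomTournament n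
        {T | (maxArborescence T 2 2 : ℝ) - g n ≤ (3 / 4 : ℝ) * n}) atTop (𝓝 1)) := by
  constructor
  -- no error term is needed, as the argument gives the larger constant `11 / 16`
  · refine ⟨fun _ => 0, isLittleO_zero _ _, ?_⟩
    simpa only [add_zero, ge_iff_le] using tendsto_maxArborescence_ge
  · refine ⟨fun n => (n : ℝ) ^ (3 / 4 : ℝ) + 1, ?_, ?_⟩
    · refine IsLittleO.add ?_ ?_
      · refine isLittleO_of_tendsto (fun n hn => by rw [hn]; norm_num) ?_
        refine ((tendsto_rpow_neg_atTop (show (0 : ℝ) < 1 / 4 by norm_num)).comp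
          (tendsto_natCast_atTop_atTop (R := ℝ))).congr' ?_
        filter_upwards [eventually_gt_atTop 0] with n hn
        have hn0 : (0 : ℝ) < n := by exact_mod_cast hn
        rw [Function.comp_apply, ← Real.rpow_sub_one hn0.ne']
        norm_num
      · exact isLittleO_const_left.2 (Or.inr (by
          simpa [Function.comp_def] using tendsto_natCast_atTop_atTop (R := ℝ)))
    · simpa only [sub_le_iff_le_add] using tendsto_maxArborescence_le
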